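/- Let $(M,g)$ be a $C^\infty$ Riemannian manifold without boundary, modelled on a real Hilbert space of finite or infinite dimension. That is, $g$ is a $C^\infty$ family of scalar products $\langle\cdot,\cdot\rangle_p$ on the tangent spaces $TM_p$, and for each $p$ the norm $\|v\|_p=\langle v,v\rangle_p^{1/2}$ defines the given topology of $TM_p$. Let $$d_M(p,q)=\inf\{L(\gamma):\gamma \text{ a } C^1 \text{ path in } M \text{ from } p \text{ to } q\}$$ be the Riemannian distance, with $d_M(p,q)=\infty$ if no such path exists; as usual, $d_M$ induces the topology of $M$. For $f:M\to\mathbb R$ and $p\in M$ let $$D^-f(p)=\{d\varphi(p) : \varphi\in C^1(M,\mathbb R),\ f-\varphi \text{ attains a local minimum at } p\}\subset T^*M_p,$$ and for $\zeta\in T^*M_p$ let $\|\zeta\|_p=\sup\{\zeta(v): v\in TM_p,\ \|v\|_p\le 1\}$. Theorem (Deville's mean value inequality). Let $f:M\to\mathbb R$ be lower semicontinuous, and assume that there is a constant $K>0$ such that $\|\zeta\|_p\le K$ for all $p\in M$ and all $\zeta\in D^-f(p)$. Then $$|f(p)-f(q)|\le K\,d_M(p,q)\quad\text{for all } p,q\in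 M.$$ -/

import Mathlib

open scoped Manifold ContDiff ENNReal Bundle

noncomputable section

/-- The (viscosity) subdifferential `D⁻f(p)` of a real function `f` on a manifold `M` without
boundary modelled on `H`: the set of the differentials `dφ(p)`, where `φ : M → ℝ` is of class `C¹`
and `f - φ` attains a local minimum at `p`. It is a set of continuous linear forms on the tangent
space of `M` at `p`. -/
def viscositySubdifferential
    {H : Type*} [NormedAddCommGroup H] [InnerProductSpace ℝ H]
    {M : Type*} [TopologicalSpace M] [ChartedSpace H M]
    (f : M → ℝ) (p : M) : Set (TangentSpace 𝓘(ℝ, H) p →L[ℝ] ℝ) :=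
  {ζ | ∃ φ : M → ℝ, ContMDiff 𝓘(ℝ, H) 𝓘(ℝ, ℝ) 1 φ ∧
    IsLocalMin (fun x => f x - φ x) p ∧
    ζ = mfderiv 𝓘(ℝ, H) 𝓘(ℝ, ℝ) φ p}

end

/-!
The inequality is local along paths. Around a point `x₀`, transport `f` by the chart to the tangent
space at `x₀`, a Hilbert space for its Riemannian norm. By continuity of the metric, the
subgradients of the transported function are bounded by `K * r` near the base point, for any
`r > 1`; here one needs that `C¹` germs read in a chart come from `C¹` functions on the whole
manifold (`exists_contMDiff_eventuallyEq_comp_extChartAt`).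

On a Hilbert space, a lower semicontinuous function `g` with subgradients bounded by `L` is locally
`L`-Lipschitz (`exists_nhds_abs_sub_le_of_subgradient_bound`). If `g y - g z > L' ‖z - y‖` with
`L' > L`, then `g` plus a cone of slope `L'` at `y`, made steep away from `y`, goes below its value
at `y`. By a smooth variational principle (`exists_isMinOn_add_sq_norm`), a small quadratic
perturbation of this sum attains its minimum, necessarily at a point other than `y`, where the cone
is differentiable and provides a subgradient of `g` of norm greater than `L`.

Near `x₀` the displacement of a path, read in the tangent space at `x₀`, is also at most `r` times
its length (`exists_nhds_enorm_symmL_extChartAt_sub_le_pathELength`). Subdividing a `C¹` path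
and letting `r` tend to `1` bounds the increment of `f` by `K` times the length of the path
(`ofReal_abs_sub_le_mul_pathELength`), and the distance is the infimum of these lengths.
-/

/-! ### Subgradient bounds on a Hilbert space -/

section

open Set Filter Topology

/-- A smooth variational principle on a Hilbert space: a lower semicontinuous function bounded below
on a closed bounded set attains its minimum after the addition of an arbitrarily small multiple of
the squared distance to a suitable point `c`.

This is the Borwein-Preiss principle, whose perturbation `∑ wₙ ‖x - xₙ‖²` collapses on a Hilbert
space to one quadratic, up to a constant: only the total weight `W n` and the weighted sum `s n` of
the points chosen so far matter. -/
theorem exists_isMinOn_add_sq_norm {E : Type*} [NormedAddCommGroup E] [InnerProductSpace ℝ E]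
    [CompleteSpace E] {S : Set E} (hS : IsClosed S) (hne : S.Nonempty) {y : E} {R : ℝ}
    (hSR : S ⊆ Metric.closedBall y R) {h : E → ℝ} (hh : LowerSemicontinuousOn h S)
    {m : ℝ} (hm : ∀ x ∈ S, m ≤ h x) {μ : ℝ} (hμ : 0 < μ) :
    ∃ z ∈ S, ∃ c ∈ Metric.closedBall y R, IsMinOn (fun x => h x + μ * ‖x - c‖ ^ 2) S z := by
  let w : ℕ → ℝ := fun n => μ * (1 / 2) ^ (n + 1)
  let W : ℕ → ℝ := fun n => μ * (1 - (1 / 2) ^ n)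
  let ε : ℕ → ℝ := fun n => w n * (1 / 4) ^ n / 2
  have hw : ∀ n, 0 < w n := fun n => by positivity
  have hW : ∀ n, W (n + 1) = W n + w n := fun n => by simp only [W, w]; ring
  have hWnn : ∀ n, 0 ≤ W n := fun n => mul_nonneg hμ.le
    (sub_nonneg.2 (pow_le_one₀ (by norm_num) (by norm_num)))
  have hε : ∀ n, 0 < ε n := fun n => by have := hw n; positivity
  have hε' : ∀ n, ε (n + 1) ≤ ε n := fun n => by
    have h1 : ε (n + 1) = ε n * (1 / 8) := by simp only [ε, w]; ring
    linarith [hε n]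
  have hB : ∀ x ∈ S, ‖x‖ ≤ ‖y‖ + R := fun x hx => by
    have h1 := hSR hx
    rw [mem_closedBall_iff_norm] at h1
    have h2 := norm_add_le (x - y) y
    rw [sub_add_cancel] at h2
    linarith
  -- approximate minimisers of the functional with quadratic weight `W n` and linear part `s`
  have hex : ∀ (n : ℕ) (s : E), ∃ x ∈ S, ∀ x' ∈ S,
      h x + W n * ‖x‖ ^ 2 - 2 * inner ℝ s x ≤ h x' + W n * ‖x'‖ ^ 2 - 2 * inner ℝ s x' + ε n := by
    intro n s
    let Q : E → ℝ := fun x => h x + W n * ‖x‖ ^ 2 - 2 * inner ℝ s x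
    have hbdd : BddBelow (Q '' S) := by
      refine ⟨m - 2 * (‖s‖ * (‖y‖ + R)), ?_⟩
      rintro _ ⟨x, hx, rfl⟩
      have h1 : inner ℝ s x ≤ ‖s‖ * (‖y‖ + R) := (real_inner_le_norm _ _).trans
        (mul_le_mul_of_nonneg_left (hB x hx) (norm_nonneg _))
      have h2 : 0 ≤ W n * ‖x‖ ^ 2 := mul_nonneg (hWnn n) (sq_nonneg _)
      simp only [Q]
      linarith [hm x hx]
    obtain ⟨_, ⟨x, hx, rfl⟩, hlt⟩ := Real.lt_sInf_add_pos (hne.image Q) (hε n)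
    exact ⟨x, hx, fun x' hx' => by
      have := csInf_le hbdd (mem_image_of_mem Q hx')
      simp only [Q] at this hlt ⊢
      linarith⟩
  choose X hXS hX using hex
  let s : ℕ → E := fun n => Nat.rec 0 (fun k t => t + w k • X k t) n
  let x : ℕ → E := fun n => X n (s n)
  have hs : ∀ n, s (n + 1) = s n + w n • x n := fun n => rfl
  have hxS : ∀ n, x n ∈ S := fun n => hXS _ _
  have hx : ∀ n, ∀ x' ∈ S, h (x n) + W n * ‖x n‖ ^ 2 - 2 * inner ℝ (s n) (x n) ≤
      h x' + W n * ‖x'‖ ^ 2 - 2 * inner ℝ (s n) x' + ε n := fun n => hX n (s n)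
  -- comparing the values at consecutive points gives
  -- `w n * ‖x n - x (n + 1)‖ ^ 2 ≤ ε n + ε (n + 1)`
  have hstep : ∀ n, dist (x n) (x (n + 1)) ≤ 1 * (1 / 2) ^ n := by
    intro n
    have h1 := hx n _ (hxS (n + 1))
    have h2 := hx (n + 1) _ (hxS n)
    simp only [hs, hW, inner_add_left, real_inner_smul_left] at h2
    rw [real_inner_self_eq_norm_sq] at h2
    have h3 := norm_sub_sq_real (x n) (x (n + 1))
    have h4 : w n * ‖x n - x (n + 1)‖ ^ 2 ≤ w n * ((1 / 2) ^ n) ^ 2 := by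
      have h5 : w n * ((1 / 2) ^ n) ^ 2 = 2 * ε n := by
        simp only [ε]
        rw [← pow_mul, mul_comm n 2, pow_mul]; norm_num; ring
      rw [h3, h5]
      linarith [hε' n]
    have h6 := le_of_mul_le_mul_left h4 (hw n)
    rw [dist_eq_norm, one_mul]
    exact (sq_le_sq₀ (norm_nonneg _) (by positivity)).1 h6
  obtain ⟨z, hz⟩ := cauchySeq_tendsto_of_complete
    (cauchySeq_of_le_geometric _ _ (by norm_num) hstep)
  have hsstep : ∀ n, dist (s n) (s (n + 1)) ≤ (μ / 2 * (‖y‖ + R)) * (1 / 2) ^ n := by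
    intro n
    rw [hs, dist_self_add_right, norm_smul, Real.norm_of_nonneg (hw n).le]
    calc w n * ‖x n‖ ≤ w n * (‖y‖ + R) := mul_le_mul_of_nonneg_left (hB _ (hxS n)) (hw n).le
      _ = _ := by simp only [w]; ring
  obtain ⟨t, ht⟩ := cauchySeq_tendsto_of_complete
    (cauchySeq_of_le_geometric _ _ (by norm_num) hsstep)
  have hWt : Tendsto W atTop (𝓝 μ) := by
    have h1 : Tendsto (fun n : ℕ => (1 / 2 : ℝ) ^ n) atTop (𝓝 0) :=
      tendsto_pow_atTop_nhds_zero_of_lt_one (by norm_num) (by norm_num)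
    simpa only [sub_zero, mul_one] using (h1.const_sub 1).const_mul μ
  have hεt : Tendsto ε atTop (𝓝 0) := by
    have h1 : ∀ n, ε n = μ / 4 * (1 / 8) ^ n := fun n => by
      simp only [ε, w]
      rw [show (1 / 8 : ℝ) = 1 / 2 * (1 / 4) by norm_num, mul_pow]; ring
    simp only [funext h1]
    simpa using (tendsto_pow_atTop_nhds_zero_of_lt_one (r := (1 / 8 : ℝ)) (by norm_num)
      (by norm_num)).const_mul (μ / 4)
  have hzS : z ∈ S := hS.mem_of_tendsto hz (Eventually.of_forall hxS)
  have hsball : ∀ n, ‖s n - W n • y‖ ≤ W n * R := by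
    intro n
    induction n with
    | zero => simp [s, W]
    | succ n ih =>
      have h1 : s (n + 1) - W (n + 1) • y = (s n - W n • y) + w n • (x n - y) := by
        rw [hs, hW, add_smul, smul_sub]; abel
      have h2 := hSR (hxS n)
      rw [mem_closedBall_iff_norm] at h2
      rw [h1, hW, add_mul]
      refine (norm_add_le _ _).trans (add_le_add ih ?_)
      rw [norm_smul, Real.norm_of_nonneg (hw n).le]
      exact mul_le_mul_of_nonneg_left h2 (hw n).le
  have htball : ‖t - μ • y‖ ≤ μ * R :=
    le_of_tendsto_of_tendsto' (ht.sub (hWt.smul_const y)).norm (hWt.mul_const R) hsball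
  refine ⟨z, hzS, μ⁻¹ • t, ?_, fun x' hx' => ?_⟩
  · rw [mem_closedBall_iff_norm]
    have h1 : μ⁻¹ • t - y = μ⁻¹ • (t - μ • y) := by
      rw [smul_sub, smul_smul, inv_mul_cancel₀ hμ.ne', one_smul]
    rw [h1, norm_smul, Real.norm_of_nonneg (inv_pos.2 hμ).le, inv_mul_le_iff₀ hμ]
    exact htball
  · have hlim : h z ≤ h x' + μ * ‖x'‖ ^ 2 - 2 * inner ℝ t x' + 0 -
        (μ * ‖z‖ ^ 2 - 2 * inner ℝ t z) := by
      have hr := (((hWt.mul_const (‖x'‖ ^ 2)).const_add (h x')).sub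
        ((ht.inner (tendsto_const_nhds (x := x'))).const_mul 2)).add hεt |>.sub
        ((hWt.mul (hz.norm.pow 2)).sub ((ht.inner hz).const_mul 2))
      refine le_of_forall_lt fun a ha => ?_
      obtain ⟨b, hab, hb⟩ := exists_between ha
      have hzw : Tendsto x atTop (𝓝[S] z) :=
        tendsto_nhdsWithin_iff.2 ⟨hz, Eventually.of_forall hxS⟩
      refine hab.trans_le (ge_of_tendsto hr ?_)
      filter_upwards [hzw.eventually (hh z hzS b hb)] with n hn
      linarith [hx n x' hx']
    have hsq : ∀ v : E, μ * ‖v - μ⁻¹ • t‖ ^ 2 =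
        μ * ‖v‖ ^ 2 - 2 * inner ℝ t v + μ * ‖μ⁻¹ • t‖ ^ 2 := by
      intro v
      rw [norm_sub_sq_real, real_inner_smul_right, real_inner_comm]
      field_simp
    simp only [mem_ofPred_eq, hsq]
    linarith

/-- The one-sided estimate behind the local Lipschitz bound. For `L' > L`, the function
`g + L' ‖· - y‖ + (2 ‖· - y‖ / ρ) ^ N` is at least `g y` on the closed ball. Otherwise a small
perturbation of it has a minimum away from `y` and from the sphere, and there `g` has a subgradient
of norm larger than `L`. The power forces minimisers off the sphere once `N` is large, and it
disappears on the ball of half the radius when `N` tends to infinity. -/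
theorem sub_le_mul_norm_of_subgradient_bound {E : Type*} [NormedAddCommGroup E]
    [InnerProductSpace ℝ E] [CompleteSpace E] {g : E → ℝ} {y : E} {ρ L m : ℝ} (hρ : 0 < ρ)
    (hL : 0 ≤ L) (hg : LowerSemicontinuousOn g (Metric.closedBall y ρ))
    (hm : ∀ x ∈ Metric.closedBall y ρ, m ≤ g x)
    (hbound : ∀ z ∈ Metric.ball y ρ, ∀ φ : E → ℝ, ContDiffAt ℝ 1 φ z →
      IsLocalMin (fun x => g x - φ x) z → ‖fderiv ℝ φ z‖ ≤ L)
    {z : E} (hz : ‖z - y‖ < ρ / 2) : g y - g z ≤ L * ‖z - y‖ := by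
  have key : ∀ L', L < L' → ∀ N : ℕ, 1 ≤ N → g y - m ≤ 2 ^ N →
      g y - g z ≤ L' * ‖z - y‖ + (2 / ρ * ‖z - y‖) ^ N := by
    intro L' hL' N hN hNm
    by_contra! hlt
    let P : ℝ → ℝ := fun t => L' * t + (2 / ρ * t) ^ N
    set δ : ℝ := g y - g z - (L' * ‖z - y‖ + (2 / ρ * ‖z - y‖) ^ N) with hδ
    have hδpos : 0 < δ := by rw [hδ]; linarith
    obtain ⟨μ, hμ, hμ1, hμ2⟩ : ∃ μ > 0, μ * (2 * ρ) ^ 2 < δ ∧ 2 * μ * (2 * ρ) < L' - L := by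
      have h1 : Tendsto (fun μ : ℝ => μ * (2 * ρ) ^ 2) (𝓝[>] 0) (𝓝 0) := by
        have : Continuous fun μ : ℝ => μ * (2 * ρ) ^ 2 := by fun_prop
        simpa using (this.tendsto 0).mono_left nhdsWithin_le_nhds
      have h2 : Tendsto (fun μ : ℝ => 2 * μ * (2 * ρ)) (𝓝[>] 0) (𝓝 0) := by
        have : Continuous fun μ : ℝ => 2 * μ * (2 * ρ) := by fun_prop
        simpa using (this.tendsto 0).mono_left nhdsWithin_le_nhds
      obtain ⟨μ, h3, h4, h5⟩ := ((h1.eventually (gt_mem_nhds hδpos)).and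
        ((h2.eventually (gt_mem_nhds (sub_pos.2 hL'))).and self_mem_nhdsWithin)).exists
      exact ⟨μ, h5, h3, h4⟩
    have hPcont : Continuous fun x : E => P ‖x - y‖ := by simp only [P]; fun_prop
    have hPnn : ∀ t, 0 ≤ t → 0 ≤ P t := fun t ht => by
      have := hL.trans hL'.le
      positivity
    obtain ⟨w, hwS, c, hc, hmin⟩ := exists_isMinOn_add_sq_norm (S := Metric.closedBall y ρ)
      Metric.isClosed_closedBall ⟨y, Metric.mem_closedBall_self hρ.le⟩ subset_rfl
      (h := fun x => g x + P ‖x - y‖) (hg.add (hPcont.lowerSemicontinuous.lowerSemicontinuousOn _))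
      (m := m) (fun x hx => by linarith [hm x hx, hPnn _ (norm_nonneg (x - y))]) hμ
    have hzS : z ∈ Metric.closedBall y ρ := by rw [mem_closedBall_iff_norm]; linarith
    have hdist : ∀ x ∈ Metric.closedBall y ρ, ‖x - c‖ ≤ 2 * ρ := fun x hx => by
      rw [← dist_eq_norm]
      have h1 := dist_triangle_right x c y
      rw [Metric.mem_closedBall] at hx hc
      linarith
    -- the quadratic perturbation is too small to offset the gap `δ` at `z`
    have hwlt : g w + P ‖w - y‖ < g y := by
      have h1 : g w + P ‖w - y‖ + μ * ‖w - c‖ ^ 2 ≤ g z + P ‖z - y‖ + μ * ‖z - c‖ ^ 2 := hmin hzS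
      have h2 : μ * ‖z - c‖ ^ 2 ≤ μ * (2 * ρ) ^ 2 := by gcongr; exact hdist z hzS
      have h3 : 0 ≤ μ * ‖w - c‖ ^ 2 := by positivity
      simp only [P] at h1 ⊢
      linarith
    have hwy : w ≠ y := by
      rintro rfl
      have : P 0 = 0 := by simp only [P]; rw [mul_zero, mul_zero, zero_pow (by lia), add_zero]
      rw [sub_self, norm_zero, this, add_zero] at hwlt
      exact lt_irrefl _ hwlt
    have hτ : 0 < ‖w - y‖ := norm_pos_iff.2 (sub_ne_zero.2 hwy)
    have hwball : w ∈ Metric.ball y ρ := by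
      rw [mem_ball_iff_norm]
      refine lt_of_le_of_ne (mem_closedBall_iff_norm.1 hwS) fun heq => ?_
      -- on the sphere the power equals `2 ^ N ≥ g y - m`
      have h1 : 2 / ρ * ρ = 2 := by field_simp
      rw [heq] at hwlt
      have h2 : 0 ≤ L' * ρ := mul_nonneg (hL.trans hL'.le) hρ.le
      simp only [P, h1] at hwlt
      linarith [hm w hwS]
    let φ : E → ℝ := fun x => -(P ‖x - y‖ + μ * ‖x - c‖ ^ 2)
    have hφ : ContDiffAt ℝ 1 φ w := by
      have h1 : ContDiffAt ℝ 1 (fun x : E => ‖x - y‖) w :=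
        (contDiffAt_id.sub contDiffAt_const).norm ℝ (sub_ne_zero.2 hwy)
      have h2 : ContDiffAt ℝ 1 (fun x : E => ‖x - c‖ ^ 2) w :=
        (contDiffAt_id.sub contDiffAt_const).norm_sq ℝ
      exact (((contDiffAt_const.mul h1).add ((contDiffAt_const.mul h1).pow N)).add
        (contDiffAt_const.mul h2)).neg
    have hloc : IsLocalMin (fun x => g x - φ x) w := by
      filter_upwards [Metric.isOpen_ball.mem_nhds hwball] with x hx
      have h1 : g w + P ‖w - y‖ + μ * ‖w - c‖ ^ 2 ≤ g x + P ‖x - y‖ + μ * ‖x - c‖ ^ 2 :=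
        hmin (Metric.ball_subset_closedBall hx)
      simp only [φ]
      linarith
    have hle := hbound w hwball φ hφ hloc
    -- differentiate `φ` at `w` in the radial direction `u`
    set u : E := ‖w - y‖⁻¹ • (w - y) with hu
    have hun : ‖u‖ = 1 := norm_smul_inv_norm (𝕜 := ℝ) (sub_ne_zero.2 hwy)
    have hline : HasDerivAt (fun t : ℝ => w + t • u) u 0 := by
      simpa using ((hasDerivAt_id (0 : ℝ)).smul_const u).const_add w
    have hφ' : HasFDerivAt φ (fderiv ℝ φ w) w := (hφ.differentiableAt one_ne_zero).hasFDerivAt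
    have hd1 : HasDerivAt (fun t : ℝ => φ (w + t • u)) (fderiv ℝ φ w u) 0 :=
      hφ'.comp_hasDerivAt_of_eq (0 : ℝ) hline (by simp)
    have hslope : fderiv ℝ φ w u ≤ -(L' - 2 * μ * (2 * ρ)) := by
      have h1 := hd1.tendsto_slope_zero_right
      refine le_of_tendsto h1 ?_
      filter_upwards [self_mem_nhdsWithin] with t ht
      have ht : 0 < t := ht
      have h2 : ‖w + t • u - y‖ = ‖w - y‖ + t := by
        have h3 : ‖w - y‖ • u = w - y := by
          rw [hu, smul_smul, mul_inv_cancel₀ hτ.ne', one_smul]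
        have : w + t • u - y = (‖w - y‖ + t) • u := by
          rw [add_smul, h3]; abel
        rw [this, norm_smul, hun, mul_one, Real.norm_of_nonneg (by positivity)]
      have h3 : (2 / ρ * ‖w - y‖) ^ N ≤ (2 / ρ * (‖w - y‖ + t)) ^ N := by gcongr; linarith
      have h4 : ‖w - c‖ ^ 2 - 2 * t * (2 * ρ) ≤ ‖w + t • u - c‖ ^ 2 := by
        rw [show w + t • u - c = (w - c) + t • u by abel, norm_add_sq_real,
          real_inner_smul_right]
        have h5 := neg_le_of_abs_le (abs_real_inner_le_norm (w - c) u)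
        rw [hun, mul_one] at h5
        nlinarith [hdist w hwS, sq_nonneg ‖t • u‖]
      have h6 : φ (w + t • u) - φ w ≤ -(L' - 2 * μ * (2 * ρ)) * t := by
        simp only [φ, P, h2]
        nlinarith
      rw [zero_add, zero_smul, add_zero, smul_eq_mul, inv_mul_le_iff₀ ht]
      linarith
    have hop := (neg_le_of_abs_le ((fderiv ℝ φ w).le_opNorm u))
    rw [hun, mul_one] at hop
    linarith
  have hq : 2 / ρ * ‖z - y‖ < 1 := by
    rw [div_mul_eq_mul_div, div_lt_one hρ]; linarith
  refine le_of_forall_gt_imp_ge_of_dense fun a ha => ?_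
  obtain ⟨L', hL', hL'a⟩ : ∃ L', L < L' ∧ L' * ‖z - y‖ < a := by
    have h1 : Tendsto (fun l : ℝ => l * ‖z - y‖) (𝓝[>] L) (𝓝 (L * ‖z - y‖)) :=
      ((continuous_id.mul continuous_const).tendsto L).mono_left nhdsWithin_le_nhds
    obtain ⟨l, h2, h3⟩ := ((h1.eventually (gt_mem_nhds ha)).and self_mem_nhdsWithin).exists
    exact ⟨l, h3, h2⟩
  have hlim : Tendsto (fun N : ℕ => L' * ‖z - y‖ + (2 / ρ * ‖z - y‖) ^ N) atTop
      (𝓝 (L' * ‖z - y‖ + 0)) :=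
    (tendsto_pow_atTop_nhds_zero_of_lt_one (by positivity) hq).const_add _
  have h2N := tendsto_pow_atTop_atTop_of_one_lt (one_lt_two : (1 : ℝ) < 2)
  refine (ge_of_tendsto hlim ?_).trans (by linarith)
  filter_upwards [eventually_ge_atTop 1, h2N.eventually_ge_atTop (g y - m)] with N hN hNm
  exact key L' hL' N hN hNm

/-- A lower semicontinuous function on a Hilbert space with subgradients bounded by `L` near `x₀` is
`L`-Lipschitz near `x₀`. No upper bound on `g` is needed, since the radius in
`sub_le_mul_norm_of_subgradient_bound` does not depend on the value at the centre. -/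
theorem exists_nhds_abs_sub_le_of_subgradient_bound {E : Type*} [NormedAddCommGroup E]
    [InnerProductSpace ℝ E] [CompleteSpace E] {g : E → ℝ} {x₀ : E} {U : Set E} (hU : U ∈ 𝓝 x₀)
    {L : ℝ} (hL : 0 ≤ L) (hg : LowerSemicontinuousOn g U)
    (hbound : ∀ z ∈ U, ∀ φ : E → ℝ, ContDiffAt ℝ 1 φ z →
      IsLocalMin (fun x => g x - φ x) z → ‖fderiv ℝ φ z‖ ≤ L) :
    ∃ V ∈ 𝓝 x₀, ∀ x ∈ V, ∀ y ∈ V, |g x - g y| ≤ L * ‖x - y‖ := by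
  -- lower semicontinuity at `x₀` bounds `g` from below near `x₀`
  have hUlow : ∀ᶠ x in 𝓝 x₀, x ∈ U ∧ g x₀ - 1 ≤ g x := by
    have h1 := hg x₀ (mem_of_mem_nhds hU) (g x₀ - 1) (by linarith)
    rw [nhdsWithin_eq_nhds.2 hU] at h1
    filter_upwards [hU, h1] with x hx hx' using ⟨hx, hx'.le⟩
  obtain ⟨r, hr, hball⟩ := Metric.eventually_nhds_iff_ball.1 hUlow
  have hsub : ∀ y ∈ Metric.ball x₀ (r / 8), Metric.closedBall y (r / 2) ⊆ Metric.ball x₀ r := by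
    intro y hy
    refine Metric.closedBall_subset_ball' ?_
    rw [Metric.mem_ball] at hy
    linarith
  have key : ∀ x ∈ Metric.ball x₀ (r / 8), ∀ y ∈ Metric.ball x₀ (r / 8),
      g y - g x ≤ L * ‖x - y‖ := by
    intro x hx y hy
    refine sub_le_mul_norm_of_subgradient_bound (half_pos hr) hL
      (hg.mono fun v hv => (hball v (hsub y hy hv)).1) (m := g x₀ - 1)
      (fun v hv => (hball v (hsub y hy hv)).2)
      (fun v hv => hbound v (hball v (hsub y hy (Metric.ball_subset_closedBall hv))).1) ?_
    rw [← dist_eq_norm]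
    have h1 := dist_triangle_right x y x₀
    rw [Metric.mem_ball] at hx hy
    linarith
  refine ⟨_, Metric.ball_mem_nhds x₀ (by positivity : 0 < r / 8),
    fun x hx y hy => abs_le.2 ⟨?_, ?_⟩⟩
  · linarith [key x hx y hy]
  · have := key y hy x hx
    rwa [norm_sub_rev] at this

end

/-! ### The local Lipschitz bound on a Riemannian manifold -/

section

open Set Filter Topology

/-- A `C¹` germ read in a chart extends to a `C¹` function on the whole manifold. Closed balls of
the chart need not be compact, so regularity of `M` is used to find a ball whose preimage is closed
in `M`. -/
theorem exists_contMDiff_eventuallyEq_comp_extChartAt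
    {H : Type*} [NormedAddCommGroup H] [InnerProductSpace ℝ H]
    {M : Type*} [TopologicalSpace M] [RegularSpace M] [ChartedSpace H M]
    [IsManifold 𝓘(ℝ, H) 1 M] {x₀ w : M} (hw : w ∈ (extChartAt 𝓘(ℝ, H) x₀).source) {ψ : H → ℝ}
    (hψ : ContDiffAt ℝ 1 ψ (extChartAt 𝓘(ℝ, H) x₀ w)) :
    ∃ Φ : M → ℝ, ContMDiff 𝓘(ℝ, H) 𝓘(ℝ, ℝ) 1 Φ ∧ Φ =ᶠ[𝓝 w] ψ ∘ extChartAt 𝓘(ℝ, H) x₀ := by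
  classical
  set e := extChartAt 𝓘(ℝ, H) x₀ with he
  have hopen : IsOpen e.source := isOpen_extChartAt_source x₀
  obtain ⟨V, hVw, hVclosed, hVe⟩ := exists_mem_nhds_isClosed_subset (hopen.mem_nhds hw)
  have hVpre : e.symm ⁻¹' V ∈ 𝓝 (e w) := by
    refine (continuousAt_extChartAt_symm' hw).preimage_mem_nhds ?_
    rwa [e.left_inv hw]
  have htarget : e.target ∈ 𝓝 (e w) := extChartAt_target_mem_nhds' (e.map_source hw)
  have hψev : ∀ᶠ v in 𝓝 (e w), ContDiffAt ℝ 1 ψ v := hψ.eventually (by simp)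
  obtain ⟨R, hR, hball⟩ := Metric.nhds_basis_closedBall.mem_iff.1
    (inter_mem (inter_mem hVpre htarget) hψev)
  let b : ContDiffBump (e w) := ⟨R / 2, R, by positivity, by linarith⟩
  have hbψ : ContDiff ℝ 1 fun v => b v * ψ v := by
    rw [contDiff_iff_contDiffAt]
    intro v
    by_cases hv : v ∈ Metric.closedBall (e w) R
    · exact b.contDiff.contDiffAt.mul (hball hv).2
    · have h1 : (fun v => b v * ψ v) =ᶠ[𝓝 v] fun _ => 0 := by
        filter_upwards [Metric.isClosed_closedBall.isOpen_compl.mem_nhds hv] with u hu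
        rw [b.zero_of_le_dist, zero_mul]
        have hu : ¬ dist u (e w) ≤ R := hu
        exact (not_le.1 hu).le
      exact contDiffAt_const.congr_of_eventuallyEq h1
  let S : Set M := V ∩ e ⁻¹' Metric.closedBall (e w) R
  have hS : IsClosed S := ((continuousOn_extChartAt x₀).mono hVe).preimage_isClosed_of_isClosed
    hVclosed Metric.isClosed_closedBall
  let Φ : M → ℝ := fun x => if x ∈ e.source then b (e x) * ψ (e x) else 0
  have hΦ0 : ∀ x ∉ S, Φ x = 0 := by
    intro x hx
    by_cases hxe : x ∈ e.source
    · simp only [Φ, if_pos hxe]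
      rw [b.zero_of_le_dist, zero_mul]
      by_contra! hlt
      have h1 : e x ∈ Metric.closedBall (e w) R := hlt.le
      refine hx ⟨?_, h1⟩
      have := (hball h1).1.1
      rwa [mem_preimage, e.left_inv hxe] at this
    · simp only [Φ, if_neg hxe]
  refine ⟨Φ, fun x => ?_, ?_⟩
  · by_cases hx : x ∈ S
    · have hxe : x ∈ e.source := hVe hx.1
      have h1 : ContMDiffAt 𝓘(ℝ, H) 𝓘(ℝ, ℝ) 1 ((fun v => b v * ψ v) ∘ e) x :=
        hbψ.contDiffAt.contMDiffAt.comp x (contMDiffAt_extChartAt' (by simpa [e] using hxe))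
      refine h1.congr_of_eventuallyEq ?_
      filter_upwards [hopen.mem_nhds hxe] with u hu
      simp only [Φ, if_pos hu, Function.comp_apply]
    · refine contMDiffAt_const (c := (0 : ℝ)) |>.congr_of_eventuallyEq ?_
      filter_upwards [hS.isOpen_compl.mem_nhds hx] with u hu using hΦ0 u hu
  · have h1 := (continuousAt_extChartAt' (I := 𝓘(ℝ, H)) hw).eventually b.eventuallyEq_one
    filter_upwards [hopen.mem_nhds hw, h1] with u hu hu'
    simp only [Φ, if_pos hu, Function.comp_apply]
    rw [← he] at hu'
    rw [hu', Pi.one_apply, one_mul]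

variable {H : Type*} [NormedAddCommGroup H] [InnerProductSpace ℝ H]
  {M : Type*} [TopologicalSpace M] [ChartedSpace H M] [IsManifold 𝓘(ℝ, H) 1 M]
  [Bundle.RiemannianBundle (fun x : M => TangentSpace 𝓘(ℝ, H) x)]

theorem isContinuousRiemannianBundle_of_isContMDiffRiemannianBundle {n : ℕ∞ω}
    [h : IsContMDiffRiemannianBundle 𝓘(ℝ, H) n H (fun x : M => TangentSpace 𝓘(ℝ, H) x)] :
    IsContinuousRiemannianBundle H (fun x : M => TangentSpace 𝓘(ℝ, H) x) := by
  obtain ⟨g, hg, hg'⟩ := h.exists_contMDiff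
  exact ⟨g, hg.continuous, hg'⟩

variable [IsContinuousRiemannianBundle H (fun x : M => TangentSpace 𝓘(ℝ, H) x)]

/-- Near `x₀` the function `f` is `K * r`-Lipschitz for the norm of the tangent space at `x₀`, read
in the chart at `x₀`. The Hilbert space estimate is applied in the tangent space at `x₀` with its
Riemannian norm; the factor `r` accounts for the variation of the metric. -/
theorem exists_nhds_abs_sub_le_norm_extChartAt_sub [CompleteSpace H] [RegularSpace M]
    {f : M → ℝ} (hf : LowerSemicontinuous f) {K : ℝ} (hK : 0 ≤ K)
    (hbound : ∀ p : M, ∀ ζ ∈ viscositySubdifferential (H := H) f p, ‖ζ‖ ≤ K)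
    (x₀ : M) {r : ℝ} (hr : 1 < r) :
    ∃ V ∈ 𝓝 x₀, ∀ x ∈ V, ∀ y ∈ V, |f x - f y| ≤ K * r *
      ‖(trivializationAt H (fun x : M => TangentSpace 𝓘(ℝ, H) x) x₀).symmL ℝ x₀
        (extChartAt 𝓘(ℝ, H) x₀ x - extChartAt 𝓘(ℝ, H) x₀ y)‖ := by
  set τ := trivializationAt H (fun x : M => TangentSpace 𝓘(ℝ, H) x) x₀
  set e := extChartAt 𝓘(ℝ, H) x₀ with he
  have hx₀ : x₀ ∈ τ.baseSet := FiberBundle.mem_baseSet_trivializationAt' x₀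
  -- `A` identifies the tangent space at `x₀`, with its Riemannian norm, with the model space `H`
  let A : TangentSpace 𝓘(ℝ, H) x₀ ≃L[ℝ] H := τ.continuousLinearEquivAt ℝ x₀ hx₀
  have hAsymm : ∀ v, A.symm v = τ.symmL ℝ x₀ v :=
    congrFun (τ.symm_continuousLinearEquivAt_eq (R := ℝ) hx₀)
  have hA : ∀ v, A v = τ.continuousLinearMapAt ℝ x₀ v :=
    congrFun (τ.coe_continuousLinearEquivAt_eq (R := ℝ) hx₀)
  have : CompleteSpace (TangentSpace 𝓘(ℝ, H) x₀) :=
    (completeSpace_congr (e := A.toEquiv) A.isUniformEmbedding).2 inferInstance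
  have hx₀e : x₀ ∈ e.source := mem_extChartAt_source x₀
  have hev : ∀ᶠ y in 𝓝 x₀, y ∈ e.source ∧
      ‖τ.symmL ℝ y ∘L τ.continuousLinearMapAt ℝ x₀‖ < r :=
    Filter.Eventually.and (extChartAt_source_mem_nhds x₀)
      (eventually_norm_symmL_trivializationAt_comp_self_lt H
        (fun x : M => TangentSpace 𝓘(ℝ, H) x) x₀ hr)
  let U : Set (TangentSpace 𝓘(ℝ, H) x₀) := {v | A v ∈ e.target ∧
    (e.symm (A v) ∈ e.source ∧
      ‖τ.symmL ℝ (e.symm (A v)) ∘L τ.continuousLinearMapAt ℝ x₀‖ < r)}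
  have hU : U ∈ 𝓝 (A.symm (e x₀)) := by
    have hAc : Tendsto A (𝓝 (A.symm (e x₀))) (𝓝 (e x₀)) := by
      have := A.continuous.tendsto (A.symm (e x₀))
      rwa [A.apply_symm_apply] at this
    have h2 : Tendsto e.symm (𝓝 (e x₀)) (𝓝 x₀) := by
      have : ContinuousAt e.symm (e x₀) := continuousAt_extChartAt_symm x₀
      rwa [ContinuousAt, e.left_inv hx₀e] at this
    exact Filter.Eventually.and (hAc.eventually (extChartAt_target_mem_nhds x₀))
      ((h2.comp hAc).eventually hev)
  have hcont : ContinuousOn (fun v => e.symm (A v)) U :=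
    (continuousOn_extChartAt_symm x₀).comp A.continuous.continuousOn fun v hv => hv.1
  have hlsc : LowerSemicontinuousOn (fun v => f (e.symm (A v))) U := fun v hv a ha =>
    (hcont v hv).eventually (hf _ a ha)
  have hsub : ∀ z ∈ U, ∀ φ : TangentSpace 𝓘(ℝ, H) x₀ → ℝ, ContDiffAt ℝ 1 φ z →
      IsLocalMin (fun v => f (e.symm (A v)) - φ v) z → ‖fderiv ℝ φ z‖ ≤ K * r := by
    rintro z ⟨hz, hzs, hzr⟩ φ hφ hmin
    set w := e.symm (A z) with hw
    have hew : e w = A z := e.right_inv hz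
    have hψ : ContDiffAt ℝ 1 (fun v => φ (A.symm v)) (e w) := by
      refine ContDiffAt.comp (e w) ?_ A.symm.contDiff.contDiffAt
      rwa [hew, A.symm_apply_apply]
    obtain ⟨Φ, hΦ, hΦeq⟩ := exists_contMDiff_eventuallyEq_comp_extChartAt hzs hψ
    have hΦmin : IsLocalMin (fun x => f x - Φ x) w := by
      have h1 : Tendsto (fun x => A.symm (e x)) (𝓝 w) (𝓝 z) := by
        have h2 : ContinuousAt (fun x => A.symm (e x)) w :=
          A.symm.continuous.continuousAt.comp (continuousAt_extChartAt' hzs)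
        rwa [ContinuousAt, hew, A.symm_apply_apply] at h2
      have hwΦ := hΦeq.self_of_nhds
      simp only [Function.comp_apply, ← he, hew, A.symm_apply_apply] at hwΦ
      filter_upwards [h1.eventually hmin, hΦeq, (isOpen_extChartAt_source x₀).mem_nhds hzs]
        with x hx hx' hxs
      simp only [A.apply_symm_apply] at hx
      rw [e.left_inv hxs] at hx
      rw [hwΦ, hx']
      exact hx
    have hws : w ∈ (chartAt H x₀).source := by simpa [e] using hzs
    -- the differential is typed with values in `ℝ`, as the norm in `hbound` is
    let ζ : TangentSpace 𝓘(ℝ, H) w →L[ℝ] ℝ := mfderiv 𝓘(ℝ, H) 𝓘(ℝ, ℝ) Φ w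
    have hd : ζ =
        (fderiv ℝ φ z ∘L (A.symm : H →L[ℝ] TangentSpace 𝓘(ℝ, H) x₀)) ∘L
          τ.continuousLinearMapAt ℝ w := by
      have h1 : HasFDerivAt (fun v => φ (A.symm v))
          (fderiv ℝ φ z ∘L (A.symm : H →L[ℝ] TangentSpace 𝓘(ℝ, H) x₀)) (e w) := by
        refine HasFDerivAt.comp (e w) ?_ A.symm.hasFDerivAt
        rw [hew, A.symm_apply_apply]
        exact (hφ.differentiableAt one_ne_zero).hasFDerivAt
      have h2 : HasMFDerivAt 𝓘(ℝ, H) 𝓘(ℝ, H) e w (τ.continuousLinearMapAt ℝ w) := by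
        rw [TangentBundle.continuousLinearMapAt_trivializationAt hws]
        exact (mdifferentiableAt_extChartAt hws).hasMFDerivAt
      exact ((h1.hasMFDerivAt.comp w h2).congr_of_eventuallyEq hΦeq).mfderiv
    have hζ : ‖ζ‖ ≤ K := hbound w _ ⟨Φ, hΦ, hΦmin, rfl⟩
    have hwτ : w ∈ τ.baseSet := hws
    refine ContinuousLinearMap.opNorm_le_bound _ (mul_nonneg hK (zero_le_one.trans hr.le))
      fun u => ?_
    -- `τ.symmL ℝ w (A u)` is `u` carried to the tangent space at `w` through the chart
    have hu : fderiv ℝ φ z u = ζ (τ.symmL ℝ w (A u)) := by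
      rw [hd]
      simp only [ContinuousLinearMap.comp_apply, ContinuousLinearEquiv.coe_coe]
      rw [τ.continuousLinearMapAt_symmL hwτ, A.symm_apply_apply]
    rw [hu]
    refine (ζ.le_opNorm _).trans ?_
    rw [mul_assoc]
    refine mul_le_mul hζ ?_ (norm_nonneg _) hK
    rw [hA]
    exact ((τ.symmL ℝ w ∘L τ.continuousLinearMapAt ℝ x₀).le_opNorm u).trans
      (mul_le_mul_of_nonneg_right hzr.le (norm_nonneg _))
  obtain ⟨W, hW, hWf⟩ := exists_nhds_abs_sub_le_of_subgradient_bound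
    (g := fun v => f (e.symm (A v))) hU (mul_nonneg hK (zero_le_one.trans hr.le)) hlsc hsub
  refine ⟨e.source ∩ (fun x => A.symm (e x)) ⁻¹' W, inter_mem (extChartAt_source_mem_nhds x₀)
      ((A.symm.continuous.continuousAt.comp (continuousAt_extChartAt x₀)).preimage_mem_nhds hW), ?_⟩
  rintro x ⟨hx, hxW⟩ y ⟨hy, hyW⟩
  have := hWf _ hxW _ hyW
  simp only [A.apply_symm_apply] at this
  rwa [e.left_inv hx, e.left_inv hy, ← map_sub, hAsymm] at this

/-! ### Integration along paths -/

/-- For paths staying close to `x₀`, the displacement read in the chart at `x₀` is at most `r` times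
the length of the path, for the norm of the tangent space at `x₀`; the factor `r > 1` accounts for
the variation of the metric. -/
theorem exists_nhds_enorm_symmL_extChartAt_sub_le_pathELength
    (x₀ : M) {r : ℝ} (hr : 1 < r) :
    ∃ V ∈ 𝓝 x₀, ∀ (γ : ℝ → M) (s t : ℝ), s ≤ t → ContMDiffOn 𝓘(ℝ, ℝ) 𝓘(ℝ, H) 1 γ (Icc s t) →
      MapsTo γ (Icc s t) V →
      ‖(trivializationAt H (fun x : M => TangentSpace 𝓘(ℝ, H) x) x₀).symmL ℝ x₀
        (extChartAt 𝓘(ℝ, H) x₀ (γ t) - extChartAt 𝓘(ℝ, H) x₀ (γ s))‖ₑ ≤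
      ENNReal.ofReal r * Manifold.pathELength 𝓘(ℝ, H) γ s t := by
  set τ := trivializationAt H (fun x : M => TangentSpace 𝓘(ℝ, H) x) x₀
  set e := extChartAt 𝓘(ℝ, H) x₀
  let B : H →L[ℝ] TangentSpace 𝓘(ℝ, H) x₀ := τ.symmL ℝ x₀
  have hev : ∀ᶠ y in 𝓝 x₀, y ∈ (chartAt H x₀).source ∧
      ‖B ∘L τ.continuousLinearMapAt ℝ y‖ < r :=
    Filter.Eventually.and (chart_source_mem_nhds H x₀)
      (eventually_norm_symmL_trivializationAt_self_comp_lt H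
        (fun x : M => TangentSpace 𝓘(ℝ, H) x) x₀ hr)
  refine ⟨_, hev, fun γ s t hst hγ hmaps => ?_⟩
  change ‖B (e (γ t) - e (γ s))‖ₑ ≤ _
  rcases hst.eq_or_lt with rfl | hlt
  · simp
  have hc : ContDiffOn ℝ 1 (e ∘ γ) (Icc s t) := by
    rw [← contMDiffOn_iff_contDiffOn]
    exact contMDiffOn_extChartAt.comp (I' := 𝓘(ℝ, H)) (t := (chartAt H x₀).source) hγ
      fun u hu => (hmaps hu).1
  have hBc : ContDiffOn ℝ 1 (fun u => B (e (γ u))) (Icc s t) := B.contDiff.comp_contDiffOn hc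
  calc ‖B (e (γ t) - e (γ s))‖ₑ = ‖B (e (γ t)) - B (e (γ s))‖ₑ := by rw [map_sub]
    _ ≤ ∫⁻ u in Icc s t, ‖derivWithin (fun u => B (e (γ u))) (Icc s t) u‖ₑ :=
      enorm_sub_le_lintegral_derivWithin_Icc_of_contDiffOn_Icc hBc hst
    _ ≤ ∫⁻ u in Icc s t, ENNReal.ofReal r *
        ‖mfderivWithin 𝓘(ℝ, ℝ) 𝓘(ℝ, H) γ (Icc s t) u 1‖ₑ := by
      refine MeasureTheory.setLIntegral_mono' measurableSet_Icc fun u hu => ?_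
      have hu' := uniqueDiffOn_Icc hlt u hu
      have h1 : derivWithin (fun u => B (e (γ u))) (Icc s t) u =
          B (derivWithin (e ∘ γ) (Icc s t) u) :=
        (B.hasFDerivAt.comp_hasDerivWithinAt u
          (hc.differentiableOn one_ne_zero u hu).hasDerivWithinAt).derivWithin hu'
      have h2 : mfderivWithin 𝓘(ℝ, ℝ) 𝓘(ℝ, H) (e ∘ γ) (Icc s t) u =
          (mfderiv 𝓘(ℝ, H) 𝓘(ℝ, H) e (γ u)) ∘L
            (mfderivWithin 𝓘(ℝ, ℝ) 𝓘(ℝ, H) γ (Icc s t) u) := by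
        apply mfderiv_comp_mfderivWithin
        · exact mdifferentiableAt_extChartAt (hmaps hu).1
        · exact hγ.mdifferentiableOn one_ne_zero u hu
        · rwa [uniqueMDiffWithinAt_iff_uniqueDiffWithinAt]
      have h3 : derivWithin (e ∘ γ) (Icc s t) u = τ.continuousLinearMapAt ℝ (γ u)
          (mfderivWithin 𝓘(ℝ, ℝ) 𝓘(ℝ, H) γ (Icc s t) u 1) := by
        rw [TangentBundle.continuousLinearMapAt_trivializationAt (hmaps hu).1,
          ← fderivWithin_derivWithin, ← mfderivWithin_eq_fderivWithin]
        exact congr($h2 1)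
      rw [h1, h3]
      have h4 := ((B ∘L τ.continuousLinearMapAt ℝ (γ u)).le_of_opNorm_le (hmaps hu).2.le
        (mfderivWithin 𝓘(ℝ, ℝ) 𝓘(ℝ, H) γ (Icc s t) u 1))
      rw [← ofReal_norm, ← ofReal_norm, ← ENNReal.ofReal_mul (by linarith)]
      exact ENNReal.ofReal_le_ofReal h4
    _ = _ := by
      rw [MeasureTheory.lintegral_const_mul' _ _ ENNReal.ofReal_ne_top,
        Manifold.pathELength_eq_lintegral_mfderivWithin_Icc]

/-- The mean value inequality along a `C¹` path, with the loss of a factor `r * r`: one `r` from the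
local Lipschitz bound and one from the comparison of lengths. The local estimates add up over a fine
subdivision of the interval, as path length is additive. -/
theorem ofReal_abs_sub_le_mul_mul_pathELength [CompleteSpace H] [RegularSpace M]
    {f : M → ℝ} (hf : LowerSemicontinuous f) {K : ℝ} (hK : 0 ≤ K)
    (hbound : ∀ p : M, ∀ ζ ∈ viscositySubdifferential (H := H) f p, ‖ζ‖ ≤ K)
    {γ : ℝ → M} {a b : ℝ} (hab : a ≤ b) (hγ : ContMDiffOn 𝓘(ℝ, ℝ) 𝓘(ℝ, H) 1 γ (Icc a b))
    {r : ℝ} (hr : 1 < r) :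
    ENNReal.ofReal |f (γ b) - f (γ a)| ≤
      ENNReal.ofReal (K * r * r) * Manifold.pathELength 𝓘(ℝ, H) γ a b := by
  have hlocal : ∀ x₀ : M, ∃ V : Set M, IsOpen V ∧ x₀ ∈ V ∧ ∀ s t, s ≤ t → Icc s t ⊆ Icc a b →
      MapsTo γ (Icc s t) V → ENNReal.ofReal |f (γ t) - f (γ s)| ≤
        ENNReal.ofReal (K * r * r) * Manifold.pathELength 𝓘(ℝ, H) γ s t := by
    intro x₀
    obtain ⟨V₁, hV₁, h₁⟩ := exists_nhds_abs_sub_le_norm_extChartAt_sub hf hK hbound x₀ hr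
    obtain ⟨V₂, hV₂, h₂⟩ := exists_nhds_enorm_symmL_extChartAt_sub_le_pathELength (H := H) x₀ hr
    obtain ⟨V, hV, hVo, hxV⟩ := mem_nhds_iff.1 (inter_mem hV₁ hV₂)
    refine ⟨V, hVo, hxV, fun s t hst hsub hmaps => ?_⟩
    have hKr : 0 ≤ K * r := mul_nonneg hK (by linarith)
    refine (ENNReal.ofReal_le_ofReal (h₁ _ (hV (hmaps (right_mem_Icc.2 hst))).1 _
      (hV (hmaps (left_mem_Icc.2 hst))).1)).trans ?_
    rw [ENNReal.ofReal_mul hKr, ENNReal.ofReal_mul hKr, mul_assoc, ofReal_norm]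
    gcongr
    exact h₂ γ s t hst (hγ.mono hsub) fun u hu => (hV (hmaps hu)).2
  choose V hVo hxV hV using hlocal
  have hγc : Continuous fun u : Icc a b => γ u := hγ.continuousOn.domRestrict
  obtain ⟨t, ht0, htmono, ⟨m, hm⟩, ht⟩ := exists_monotone_Icc_subset_open_cover_Icc hab
    (c := fun x₀ : M => (fun u : Icc a b => γ u) ⁻¹' V x₀)
    (fun x₀ => (hVo x₀).preimage hγc) (fun u _ => mem_iUnion.2 ⟨γ u, hxV _⟩)
  have hind : ∀ n, ENNReal.ofReal |f (γ (t n)) - f (γ a)| ≤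
      ENNReal.ofReal (K * r * r) * Manifold.pathELength 𝓘(ℝ, H) γ a (t n) := by
    intro n
    induction n with
    | zero => simp [ht0]
    | succ n ih =>
      have hle : (t n : ℝ) ≤ t (n + 1) := htmono n.le_succ
      obtain ⟨x₀, hx₀⟩ := ht n
      have hsub : Icc (t n : ℝ) (t (n + 1)) ⊆ Icc a b :=
        Icc_subset_Icc (t n).2.1 (t (n + 1)).2.2
      have hstep := hV x₀ (t n) (t (n + 1)) hle hsub
        fun u hu => hx₀ (a := ⟨u, hsub hu⟩) ⟨hu.1, hu.2⟩
      rw [← Manifold.pathELength_add (t n).2.1 hle, mul_add]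
      refine le_trans ?_ (add_le_add ih hstep)
      rw [← ENNReal.ofReal_add (abs_nonneg _) (abs_nonneg _), add_comm (|_|)]
      exact ENNReal.ofReal_le_ofReal (abs_sub_le _ _ _)
  have := hind m
  rwa [hm m le_rfl] at this

theorem ofReal_abs_sub_le_mul_pathELength [CompleteSpace H] [RegularSpace M]
    {f : M → ℝ} (hf : LowerSemicontinuous f) {K : ℝ} (hK : 0 < K)
    (hbound : ∀ p : M, ∀ ζ ∈ viscositySubdifferential (H := H) f p, ‖ζ‖ ≤ K)
    {γ : ℝ → M} {a b : ℝ} (hab : a ≤ b) (hγ : ContMDiffOn 𝓘(ℝ, ℝ) 𝓘(ℝ, H) 1 γ (Icc a b)) :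
    ENNReal.ofReal |f (γ b) - f (γ a)| ≤
      ENNReal.ofReal K * Manifold.pathELength 𝓘(ℝ, H) γ a b := by
  have hlim : Tendsto (fun r : ℝ => ENNReal.ofReal (K * r * r)) (𝓝[>] 1)
      (𝓝 (ENNReal.ofReal K)) := by
    have hc : Continuous fun r : ℝ => ENNReal.ofReal (K * r * r) :=
      ENNReal.continuous_ofReal.comp (by fun_prop)
    simpa using (hc.tendsto 1).mono_left nhdsWithin_le_nhds
  refine ge_of_tendsto (ENNReal.Tendsto.mul_const hlim
    (Or.inl (ENNReal.ofReal_pos.2 hK).ne')) ?_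
  filter_upwards [self_mem_nhdsWithin] with r hr
  exact ofReal_abs_sub_le_mul_mul_pathELength hf hK.le hbound hab hγ hr

end

/-- Deville's mean value inequality. `M` is a smooth Riemannian manifold without boundary modelled
on a Hilbert space `H` of finite or infinite dimension; `edist` is its Riemannian distance, with
value `∞` on pairs of points that no path joins. The norm of `ζ` is the dual norm of the norm given
by the Riemannian metric on the tangent space at `p`. -/
theorem mainTheorem7
    {H : Type*} [NormedAddCommGroup H] [InnerProductSpace ℝ H] [CompleteSpace H]
    {M : Type*} [EMetricSpace M] [ChartedSpace H M] [IsManifold 𝓘(ℝ, H) ∞ M]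
    [Bundle.RiemannianBundle (fun x : M => TangentSpace 𝓘(ℝ, H) x)]
    [IsContMDiffRiemannianBundle 𝓘(ℝ, H) ∞ H (fun x : M => TangentSpace 𝓘(ℝ, H) x)]
    [IsRiemannianManifold 𝓘(ℝ, H) M]
    (f : M → ℝ) (hf : LowerSemicontinuous f)
    (K : ℝ) (hK : 0 < K)
    (hbound : ∀ p : M, ∀ ζ ∈ viscositySubdifferential (H := H) f p, ‖ζ‖ ≤ K) :
    ∀ p q : M, ENNReal.ofReal |f p - f q| ≤ ENNReal.ofReal K * edist p q := by
  intro p q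
  have : IsContinuousRiemannianBundle H (fun x : M => TangentSpace 𝓘(ℝ, H) x) :=
    isContinuousRiemannianBundle_of_isContMDiffRiemannianBundle (n := ∞)
  have hK₀ : ENNReal.ofReal K ≠ 0 := (ENNReal.ofReal_pos.2 hK).ne'
  rw [mul_comm, ← ENNReal.div_le_iff_le_mul (Or.inl hK₀) (Or.inl ENNReal.ofReal_ne_top),
    IsRiemannianManifold.out (I := 𝓘(ℝ, H)) p q]
  refine le_of_forall_gt_imp_ge_of_dense fun c hc => ?_
  obtain ⟨γ, rfl, rfl, hγ, hlt⟩ := Manifold.exists_lt_of_riemannianEDist_lt hc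
  rw [ENNReal.div_le_iff_le_mul (Or.inl hK₀) (Or.inl ENNReal.ofReal_ne_top), mul_comm, abs_sub_comm]
  refine (ofReal_abs_sub_le_mul_pathELength hf hK hbound zero_le_one hγ).trans ?_
  gcongr
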